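/- A \emph{quadrilateral tiling} of the two-dimensional sphere $S^2$ is a (finite) cellular decomposition of $S^2$ into vertices, edges and faces such that the closure of every face is an embedded quadrilateral (a homeomorphic image of a closed square whose four corners are vertices and whose four sides are edges of the decomposition), together with a colouring of the vertices in black and white such that every edge joins vertices of different colours. Several edges may join the same two vertices. Points of the unit sphere $S^4\subset\mathbb R^5$ are called \emph{cocyclic} if they lie on a common circle in $S^4$, that is, on the intersection of $S^4$ with an affine plane of $\mathbb R^5$ that meets $S^4$ in more than one point. \textbf{Theorem.} Consider a quadrilateral tiling of the sphere $S^2$ and assign to each of its vertices a point in $S^4$ so that the points assigned to the endpoints of every edge are distinct. Assume that for all but one face of the tiling the four points assigned to the vertices of the face are cocyclic. Then the points assigned to the vertices of the remaining face are also cocyclic. (Apart from the condition on edges, the assigned points may coincide.) -/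

import Mathlib

open scoped unitInterval

/-- The four sides of the unit square `I × I`, each parametrised by `I`, in counterclockwise
order: side `i` runs from the `i`-th corner to the `(i + 1)`-st corner (indices modulo `4`). -/
noncomputable def squareSide : Fin 4 → I → I × I :=
  ![fun t => (t, 0), fun t => (1, t), fun t => (unitInterval.symm t, 1),
    fun t => (0, unitInterval.symm t)]

/-- The four corners of the unit square `I × I`, in counterclockwise order. -/
noncomputable def squareCorner (i : Fin 4) : I × I := squareSide i 0

/-- The open cells determined by the positions of the vertices, by the characteristic maps of the
edges, and by the characteristic maps of the faces: the vertices themselves, the images of the open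
unit interval, and the images of the open unit square. -/
def openCells {X V E F : Type*} (pos : V → X) (edgeMap : E → I → X) (faceMap : F → I × I → X) :
    V ⊕ E ⊕ F → Set X :=
  Sum.elim (fun v => {pos v})
    (Sum.elim (fun e => edgeMap e '' Set.Ioo 0 1)
      (fun f => faceMap f '' (Set.Ioo 0 1 ×ˢ Set.Ioo 0 1)))

/-- A quadrilateral tiling of a space `X` with vertices `V`, edges `E` and faces `F`
(finite types when `X` is a closed surface): a decomposition of `X` into open cells of
dimensions `0`, `1`, `2`, such that the closure of every `2`-cell is an embedded quadrilateral
whose corners are vertices and whose sides are edges of the decomposition, together with a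
colouring of the vertices in two colours for which every edge joins vertices of different colours.

Several edges may join the same two vertices. -/
structure QuadrilateralTiling (X : Type*) [TopologicalSpace X] (V E F : Type*) where
  /-- the position of a vertex -/
  pos : V → X
  /-- the first endpoint of an edge -/
  src : E → V
  /-- the second endpoint of an edge -/
  tgt : E → V
  /-- the parametrisation of a closed edge -/
  edgeMap : E → I → X
  /-- the corners of a face, in cyclic order -/
  corner : F → Fin 4 → V
  /-- the sides of a face, in cyclic order -/
  side : F → Fin 4 → E
  /-- the parametrisation of a closed face -/
  faceMap : F → I × I → X
  continuous_edgeMap : ∀ e, Continuous (edgeMap e)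
  injective_edgeMap : ∀ e, Function.Injective (edgeMap e)
  edgeMap_zero : ∀ e, edgeMap e 0 = pos (src e)
  edgeMap_one : ∀ e, edgeMap e 1 = pos (tgt e)
  continuous_faceMap : ∀ f, Continuous (faceMap f)
  injective_faceMap : ∀ f, Function.Injective (faceMap f)
  faceMap_corner : ∀ f i, faceMap f (squareCorner i) = pos (corner f i)
  range_faceMap_side : ∀ f i, Set.range (faceMap f ∘ squareSide i) = Set.range (edgeMap (side f i))
  pairwise_disjoint : Pairwise (Function.onFun Disjoint (openCells pos edgeMap faceMap))
  iUnion_openCells : ⋃ c, openCells pos edgeMap faceMap c = Set.univ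
  /-- the colour (black or white) of a vertex -/
  color : V → Bool
  color_ne : ∀ e, color (src e) ≠ color (tgt e)

open scoped Quaternion

/-! Since `V` is finite, some point `N` of the 4-sphere is not assigned to any vertex. Stereographic
projection from `N` turns the assigned points into quaternions. Four of them, with cyclically
consecutive ones distinct, come from cocyclic points exactly when the cross-ratio `(a - b)(b -
c)⁻¹(c - d)(d - a)⁻¹` is real (`coplanar_iff_quaternionCrossRatio`).

Real nonzero quaternions form the centre of the unit group, so this says that a product of classes
in the quotient by the centre is trivial. Label an edge, read from black to white, by the class of
the difference of its endpoints, and by the inverse class in the other direction. Colours alternate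
around a face, so the holonomy of this labelling along the boundary is the class of the cross-ratio,
up to the choice of starting corner.

It remains to see that trivial holonomy around all faces but one forces trivial holonomy around the
last. The sphere minus the centre of that face is simply connected and retracts onto the union of
the other cells. Local potentials of the labelling differ by a locally constant cocycle, which is a
coboundary there (`exists_potential`). The resulting global potential trivialises the last holonomy
as well. -/

/-! ### Locally constant cocycles on simply connected spaces -/

open Topology in
/-- Over a simply connected, locally path connected base, a locally constant cocycle
`(φ x i)⁻¹ * φ x j` on an open cover with values in a group is a coboundary. -/
theorem exists_locally_constant_trivialization {B ι G : Type*} [TopologicalSpace B]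
    [SimplyConnectedSpace B] [LocallyPathConnectedSpace B] [Group G]
    (U : ι → Set B) (hU : ∀ i, IsOpen (U i)) (hcov : ∀ x, ∃ i, x ∈ U i) (φ : B → ι → G)
    (hφ : ∀ i j, ∀ x ∈ U i ∩ U j, ∀ᶠ y in 𝓝 x, (φ y i)⁻¹ * φ y j = (φ x i)⁻¹ * φ x j) :
    ∃ h : ι → B → G, (∀ i, ∀ x ∈ U i, ∀ᶠ y in 𝓝 x, h i y = h i x) ∧
      ∀ i j, ∀ x ∈ U i ∩ U j, h j x = h i x * ((φ x i)⁻¹ * φ x j) := by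
  let _ : TopologicalSpace G := ⊥
  have : DiscreteTopology G := ⟨rfl⟩
  choose idx hidx using hcov
  -- The cocycle glues copies of the discrete space `G` into a covering of `B`. Lifting the identity
  -- of `B` gives a global section `s`, and `h i` is its coordinate over `U i`.
  let Z : FiberBundleCore ι B G :=
    { baseSet := U
      isOpen_baseSet := hU
      indexAt := idx
      mem_baseSet_at := hidx
      coordChange := fun i j x a => a * ((φ x i)⁻¹ * φ x j)
      coordChange_self := by intro i x _ v; simp
      continuousOn_coordChange := by
        rintro i j ⟨x, a⟩ ⟨hx, -⟩
        refine ContinuousAt.continuousWithinAt ?_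
        have h1 : ∀ᶠ q : B × G in 𝓝 (x, a),
            a * ((φ x i)⁻¹ * φ x j) = q.2 * ((φ q.1 i)⁻¹ * φ q.1 j) := by
          rw [nhds_prod_eq, nhds_discrete G]
          filter_upwards [(hφ i j x hx).prod_mk (Filter.eventually_pure.2 (rfl : a = a))]
            with q hq
          rw [hq.1, ← hq.2]
        exact continuousAt_const.congr h1
      coordChange_comp := by intro i j k x _ v; group }
  have cov : IsCoveringMap (Bundle.TotalSpace.proj : Z.TotalSpace → B) :=
    FiberBundle.isCoveringMap
  obtain ⟨b₀⟩ : Nonempty B := inferInstance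
  obtain ⟨s, ⟨-, hs⟩, -⟩ := cov.existsUnique_continuousMap_lifts (ContinuousMap.id B) b₀
    (⟨b₀, (1 : G)⟩ : Z.TotalSpace) rfl
  have hs' : ∀ x, (s x).1 = x := fun x => congrFun hs x
  refine ⟨fun i x => (Z.localTriv i (s x)).2, ?_, ?_⟩
  · intro i x hx
    have hc : ContinuousAt (fun y => (Z.localTriv i (s y)).2) x := by
      refine continuousAt_snd.comp (ContinuousAt.comp ?_ s.continuous.continuousAt)
      refine (Z.localTriv i).continuousAt ?_
      rw [Z.mem_localTriv_source]
      change (s x).1 ∈ U i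
      rwa [hs']
    exact hc.eventually ((isOpen_discrete {(Z.localTriv i (s x)).2}).mem_nhds rfl)
  · intro i j x hx
    let a : G := (s x).2
    change a * ((φ (s x).1 _)⁻¹ * φ (s x).1 j) = a * ((φ (s x).1 _)⁻¹ * φ (s x).1 i) * _
    rw [hs']
    group

/-! ### The unit square and its radial retraction -/

theorem squareSide_one (i : Fin 4) : squareSide i 1 = squareCorner (i + 1) := by
  fin_cases i <;> simp [squareSide, squareCorner]

theorem exists_squareSide_eq {z : I × I} (hz : z ∉ Set.Ioo (0 : I) 1 ×ˢ Set.Ioo (0 : I) 1) :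
    ∃ i t, squareSide i t = z := by
  obtain ⟨a, b⟩ := z
  by_cases ha : a = 0
  · exact ⟨3, unitInterval.symm b, by simp [squareSide, ha]⟩
  by_cases ha' : a = 1
  · exact ⟨1, b, by simp [squareSide, ha']⟩
  by_cases hb : b = 0
  · exact ⟨0, a, by simp [squareSide, hb]⟩
  by_cases hb' : b = 1
  · exact ⟨2, unitInterval.symm a, by simp [squareSide, hb']⟩
  exact absurd ⟨⟨unitInterval.pos_iff_ne_zero.2 ha, unitInterval.lt_one_iff_ne_one.2 ha'⟩,
    unitInterval.pos_iff_ne_zero.2 hb, unitInterval.lt_one_iff_ne_one.2 hb'⟩ hz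

/-- The centre of the unit interval. -/
noncomputable def intervalCenter : I := ⟨1 / 2, by norm_num, by norm_num⟩

theorem intervalCenter_mem : intervalCenter ∈ Set.Ioo (0 : I) 1 := by
  constructor <;> rw [← Subtype.coe_lt_coe] <;> norm_num [intervalCenter]

/-- The radial projection of the unit square minus its centre onto its boundary. -/
noncomputable def squareRetract (z : I × I) : I × I :=
  let m : ℝ := max |(z.1 : ℝ) - 1 / 2| |(z.2 : ℝ) - 1 / 2|
  (Set.projIcc 0 1 zero_le_one (1 / 2 + ((z.1 : ℝ) - 1 / 2) / (2 * m)),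
    Set.projIcc 0 1 zero_le_one (1 / 2 + ((z.2 : ℝ) - 1 / 2) / (2 * m)))

theorem max_abs_sub_half_pos {z : I × I} (hz : z ≠ (intervalCenter, intervalCenter)) :
    0 < max |(z.1 : ℝ) - 1 / 2| |(z.2 : ℝ) - 1 / 2| := by
  by_contra! h
  obtain ⟨h1, h2⟩ := max_le_iff.1 h
  rw [abs_nonpos_iff, sub_eq_zero] at h1 h2
  exact hz (Prod.ext (Subtype.ext h1) (Subtype.ext h2))

theorem continuousOn_squareRetract :
    ContinuousOn squareRetract {(intervalCenter, intervalCenter)}ᶜ := by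
  unfold squareRetract
  refine ContinuousOn.prodMk ?_ ?_ <;> refine continuous_projIcc.comp_continuousOn ?_ <;>
  refine continuousOn_const.add (ContinuousOn.div (by fun_prop) (by fun_prop) ?_) <;>
  · intro z hz
    have := max_abs_sub_half_pos hz
    positivity

theorem squareRetract_notMem {z : I × I} (hz : z ≠ (intervalCenter, intervalCenter)) :
    squareRetract z ∉ Set.Ioo (0 : I) 1 ×ˢ Set.Ioo (0 : I) 1 := by
  have hm := max_abs_sub_half_pos hz
  have key : ∀ x m : ℝ, 0 < m → |x| = m →
      Set.projIcc (0 : ℝ) 1 zero_le_one (1 / 2 + x / (2 * m)) ∉ Set.Ioo (0 : I) 1 := by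
    intro x m hm hx h
    rcases abs_choice x with h' | h' <;> rw [h'] at hx
    · have : 1 / 2 + x / (2 * m) = 1 := by rw [hx]; field_simp; norm_num
      rw [this, Set.projIcc_right] at h
      exact lt_irrefl _ h.2
    · have : 1 / 2 + x / (2 * m) = 0 := by
        rw [← hx] at hm ⊢
        have : x ≠ 0 := by rintro rfl; simp at hm
        field_simp; norm_num
      rw [this, Set.projIcc_left] at h
      exact lt_irrefl _ h.1
  rintro ⟨h1, h2⟩
  rcases max_choice |(z.1 : ℝ) - 1 / 2| |(z.2 : ℝ) - 1 / 2| with h | h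
  · exact key _ _ hm h.symm h1
  · exact key _ _ hm h.symm h2

theorem squareRetract_eq_self {z : I × I} (hz : z ∉ Set.Ioo (0 : I) 1 ×ˢ Set.Ioo (0 : I) 1) :
    squareRetract z = z := by
  obtain ⟨⟨a, ha0, ha1⟩, ⟨b, hb0, hb1⟩⟩ := z
  have hm : max |a - 1 / 2| |b - 1 / 2| = 1 / 2 := by
    have h1 : |a - 1 / 2| ≤ 1 / 2 := abs_le.2 ⟨by linarith, by linarith⟩
    have h2 : |b - 1 / 2| ≤ 1 / 2 := abs_le.2 ⟨by linarith, by linarith⟩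
    refine le_antisymm (max_le h1 h2) ?_
    by_contra! h
    obtain ⟨h3, h4⟩ := max_lt_iff.1 h
    rw [abs_lt] at h3 h4
    refine hz ⟨⟨?_, ?_⟩, ?_, ?_⟩ <;> rw [← Subtype.coe_lt_coe] <;> simp <;> linarith
  refine Prod.ext ?_ ?_ <;> simp only [squareRetract, hm]
  · convert Set.projIcc_of_mem zero_le_one (⟨ha0, ha1⟩ : a ∈ Set.Icc (0 : ℝ) 1) using 2
    ring
  · convert Set.projIcc_of_mem zero_le_one (⟨hb0, hb1⟩ : b ∈ Set.Icc (0 : ℝ) 1) using 2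
    ring

/-! ### Cells, open stars and the retraction off a face -/

namespace QuadrilateralTiling

variable {X V E F : Type*} [TopologicalSpace X] (T : QuadrilateralTiling X V E F)

/-- The open cells of a tiling. -/
def openCell : V ⊕ E ⊕ F → Set X := openCells T.pos T.edgeMap T.faceMap

/-- The closed cells of a tiling. -/
def closedCell : V ⊕ E ⊕ F → Set X :=
  Sum.elim (fun v => {T.pos v})
    (Sum.elim (fun e => Set.range (T.edgeMap e)) (fun f => Set.range (T.faceMap f)))

theorem openCell_subset_closedCell (c : V ⊕ E ⊕ F) : T.openCell c ⊆ T.closedCell c := by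
  rcases c with v | e | f
  · exact subset_rfl
  · exact Set.image_subset_range _ _
  · exact Set.image_subset_range _ _

theorem isClosed_closedCell [T2Space X] (c : V ⊕ E ⊕ F) : IsClosed (T.closedCell c) := by
  rcases c with v | e | f
  · exact isClosed_singleton
  · exact (isCompact_range (T.continuous_edgeMap e)).isClosed
  · exact (isCompact_range (T.continuous_faceMap f)).isClosed

theorem exists_mem_openCell (x : X) : ∃ c, x ∈ T.openCell c :=
  Set.mem_iUnion.1 (T.iUnion_openCells.symm ▸ Set.mem_univ x)

/-- The cell of a tiling that contains a given point. -/
noncomputable def cellAt (x : X) : V ⊕ E ⊕ F := (T.exists_mem_openCell x).choose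

theorem mem_openCell_cellAt (x : X) : x ∈ T.openCell (T.cellAt x) :=
  (T.exists_mem_openCell x).choose_spec

theorem cellAt_eq {x : X} {c : V ⊕ E ⊕ F} (h : x ∈ T.openCell c) : T.cellAt x = c := by
  by_contra hne
  exact Set.disjoint_left.1 (T.pairwise_disjoint hne) (T.mem_openCell_cellAt x) h

theorem mem_closedCell_cellAt (x : X) : x ∈ T.closedCell (T.cellAt x) :=
  T.openCell_subset_closedCell _ (T.mem_openCell_cellAt x)

theorem cellAt_pos (v : V) : T.cellAt (T.pos v) = Sum.inl v := T.cellAt_eq rfl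

theorem pos_injective : Function.Injective T.pos := fun v w h =>
  Sum.inl_injective (by rw [← T.cellAt_pos, ← T.cellAt_pos, h])

theorem cellAt_edgeMap (e : E) {t : I} (ht : t ∈ Set.Ioo (0 : I) 1) :
    T.cellAt (T.edgeMap e t) = Sum.inr (Sum.inl e) :=
  T.cellAt_eq (Set.mem_image_of_mem _ ht)

theorem cellAt_faceMap (f : F) {z : I × I} (hz : z ∈ Set.Ioo (0 : I) 1 ×ˢ Set.Ioo (0 : I) 1) :
    T.cellAt (T.faceMap f z) = Sum.inr (Sum.inr f) :=
  T.cellAt_eq (Set.mem_image_of_mem _ hz)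

theorem cellAt_of_mem_vertex {x : X} {v : V} (h : x ∈ T.closedCell (Sum.inl v)) :
    T.cellAt x = Sum.inl v :=
  T.cellAt_eq h

theorem cellAt_of_mem_edge {x : X} {e : E} (h : x ∈ T.closedCell (Sum.inr (Sum.inl e))) :
    T.cellAt x = Sum.inr (Sum.inl e) ∨ T.cellAt x = Sum.inl (T.src e) ∨
      T.cellAt x = Sum.inl (T.tgt e) := by
  obtain ⟨t, rfl⟩ := h
  by_cases h0 : t = 0
  · rw [h0, T.edgeMap_zero, T.cellAt_pos]; simp
  by_cases h1 : t = 1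
  · rw [h1, T.edgeMap_one, T.cellAt_pos]; simp
  exact Or.inl (T.cellAt_edgeMap e
    ⟨unitInterval.pos_iff_ne_zero.2 h0, unitInterval.lt_one_iff_ne_one.2 h1⟩)

theorem faceMap_squareSide_mem (f : F) (i : Fin 4) (t : I) :
    T.faceMap f (squareSide i t) ∈ T.closedCell (Sum.inr (Sum.inl (T.side f i))) := by
  change _ ∈ Set.range _
  rw [← T.range_faceMap_side]
  exact ⟨t, rfl⟩

theorem closedCell_side_subset (f : F) (i : Fin 4) :
    T.closedCell (Sum.inr (Sum.inl (T.side f i))) ⊆ T.closedCell (Sum.inr (Sum.inr f)) := by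
  change Set.range _ ⊆ Set.range _
  rw [← T.range_faceMap_side]
  exact Set.range_comp_subset_range _ _

theorem cellAt_of_mem_face {x : X} {f : F} (h : x ∈ T.closedCell (Sum.inr (Sum.inr f))) :
    T.cellAt x = Sum.inr (Sum.inr f) ∨
      ∃ i, x ∈ T.closedCell (Sum.inr (Sum.inl (T.side f i))) := by
  obtain ⟨z, rfl⟩ := h
  by_cases hz : z ∈ Set.Ioo (0 : I) 1 ×ˢ Set.Ioo (0 : I) 1
  · exact Or.inl (T.cellAt_faceMap f hz)
  · obtain ⟨i, t, rfl⟩ := exists_squareSide_eq hz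
    exact Or.inr ⟨i, T.faceMap_squareSide_mem f i t⟩

theorem pos_src_mem (e : E) : T.pos (T.src e) ∈ T.closedCell (Sum.inr (Sum.inl e)) :=
  ⟨0, T.edgeMap_zero e⟩

theorem pos_tgt_mem (e : E) : T.pos (T.tgt e) ∈ T.closedCell (Sum.inr (Sum.inl e)) :=
  ⟨1, T.edgeMap_one e⟩

theorem closedCell_cellAt_subset_edge {x : X} {e : E}
    (h : x ∈ T.closedCell (Sum.inr (Sum.inl e))) :
    T.closedCell (T.cellAt x) ⊆ T.closedCell (Sum.inr (Sum.inl e)) := by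
  rcases T.cellAt_of_mem_edge h with h' | h' | h' <;> rw [h']
  · exact Set.singleton_subset_iff.2 (T.pos_src_mem e)
  · exact Set.singleton_subset_iff.2 (T.pos_tgt_mem e)

theorem closedCell_cellAt_subset {x : X} {c : V ⊕ E ⊕ F} (h : x ∈ T.closedCell c) :
    T.closedCell (T.cellAt x) ⊆ T.closedCell c := by
  rcases c with v | e | f
  · rw [T.cellAt_of_mem_vertex h]
  · exact T.closedCell_cellAt_subset_edge h
  · rcases T.cellAt_of_mem_face h with h' | ⟨i, hi⟩
    · rw [h']
    · exact (T.closedCell_cellAt_subset_edge hi).trans (T.closedCell_side_subset f i)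

/-- The open star of a point: the union of the open cells whose closures contain it. -/
def openStar (x : X) : Set X := {y | x ∈ T.closedCell (T.cellAt y)}

theorem mem_openStar_self (x : X) : x ∈ T.openStar x := T.mem_closedCell_cellAt x

/-- The complement is the union of the finitely many closed cells that miss `x`: by
`closedCell_cellAt_subset`, a closed cell contains the whole closed cell of each of its points. -/
theorem isOpen_openStar [T2Space X] [Finite V] [Finite E] [Finite F] (x : X) :
    IsOpen (T.openStar x) := by
  have : T.openStar x = (⋃ c ∈ {c | x ∉ T.closedCell c}, T.closedCell c)ᶜ := by
    ext y
    simp only [openStar, Set.mem_ofPred_eq, Set.mem_compl_iff, Set.mem_iUnion, exists_prop,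
      not_exists, not_and]
    refine ⟨fun h c hc hy => hc (T.closedCell_cellAt_subset hy h), fun h => ?_⟩
    by_contra hx
    exact h _ hx (T.mem_closedCell_cellAt y)
  rw [this, isOpen_compl_iff]
  exact (Set.toFinite _).isClosed_biUnion fun c _ => T.isClosed_closedCell c

theorem cellAt_eq_of_mem_closedCell_of_face {x : X} {f : F} {c : V ⊕ E ⊕ F}
    (hx : T.cellAt x = Sum.inr (Sum.inr f)) (h : x ∈ T.closedCell c) :
    c = Sum.inr (Sum.inr f) := by
  rcases c with v | e | f'
  · rw [T.cellAt_of_mem_vertex h] at hx; cases hx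
  · rcases T.cellAt_of_mem_edge h with h' | h' | h' <;> rw [h'] at hx <;> cases hx
  · rcases T.cellAt_of_mem_face h with h' | ⟨i, hi⟩
    · rw [← hx, h']
    · rcases T.cellAt_of_mem_edge hi with h' | h' | h' <;> rw [h'] at hx <;> cases hx

theorem eq_of_edgeMap_mem_closedCell {e : E} {t : I} (ht : t ∈ Set.Ioo (0 : I) 1)
    {c : V ⊕ E ⊕ F} (h : T.edgeMap e t ∈ T.closedCell c) :
    c = Sum.inr (Sum.inl e) ∨ ∃ f i, c = Sum.inr (Sum.inr f) ∧ e = T.side f i := by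
  have key : ∀ e', T.edgeMap e t ∈ T.closedCell (Sum.inr (Sum.inl e')) → e' = e := by
    intro e' h
    rcases T.cellAt_of_mem_edge h with h' | h' | h' <;> rw [T.cellAt_edgeMap e ht] at h'
    · exact (Sum.inl_injective (Sum.inr_injective h')).symm
    · cases h'
    · cases h'
  rcases c with v | e' | f
  · have := T.cellAt_of_mem_vertex h
    rw [T.cellAt_edgeMap e ht] at this; cases this
  · rw [key e' h]; exact Or.inl rfl
  · rcases T.cellAt_of_mem_face h with h' | ⟨i, hi⟩
    · rw [T.cellAt_edgeMap e ht] at h'; cases h'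
    · exact Or.inr ⟨f, i, rfl, (key _ hi).symm⟩

theorem isOpen_openCell_face [T2Space X] [Finite V] [Finite E] [Finite F] (f : F) :
    IsOpen (T.openCell (Sum.inr (Sum.inr f))) := by
  have hmem : T.cellAt (T.faceMap f (intervalCenter, intervalCenter)) = Sum.inr (Sum.inr f) :=
    T.cellAt_faceMap f ⟨intervalCenter_mem, intervalCenter_mem⟩
  convert T.isOpen_openStar (T.faceMap f (intervalCenter, intervalCenter)) using 1
  ext y
  refine ⟨fun h => ?_, fun h => ?_⟩
  · rw [openStar, Set.mem_ofPred_eq, T.cellAt_eq h]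
    exact ⟨_, rfl⟩
  · rw [← T.cellAt_eq_of_mem_closedCell_of_face hmem h]
    exact T.mem_openCell_cellAt y

/-- The centre of a face. -/
noncomputable def faceCenter (f : F) : X := T.faceMap f (intervalCenter, intervalCenter)

theorem cellAt_faceCenter (f : F) : T.cellAt (T.faceCenter f) = Sum.inr (Sum.inr f) :=
  T.cellAt_faceMap f ⟨intervalCenter_mem, intervalCenter_mem⟩

/-- The complement of the centre of a face retracts onto the complement of the open face. -/
theorem exists_retraction [T2Space X] [Finite V] [Finite E] [Finite F] (f : F) :
    ∃ r : ({T.faceCenter f}ᶜ : Set X) → X, Continuous r ∧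
      (∀ x, T.cellAt (r x) ≠ Sum.inr (Sum.inr f)) ∧
      ∀ x, T.cellAt x.1 ≠ Sum.inr (Sum.inr f) → r x = x := by
  classical
  have hemb : Topology.IsClosedEmbedding (T.faceMap f) :=
    (T.continuous_faceMap f).isClosedEmbedding (T.injective_faceMap f)
  let Φ := hemb.isEmbedding.toHomeomorph
  have hΦ : ∀ z, (Φ z : X) = T.faceMap f z := fun z => rfl
  let inv : X → I × I := Function.invFun (T.faceMap f)
  have hinv : ∀ z, inv (T.faceMap f z) = z := Function.leftInverse_invFun (T.injective_faceMap f)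
  have hinvc : ContinuousOn inv (Set.range (T.faceMap f)) := by
    rw [continuousOn_iff_continuous_domRestrict]
    convert Φ.symm.continuous using 1
    ext1 y
    obtain ⟨z, rfl⟩ := Φ.surjective y
    rw [Φ.symm_apply_apply, Set.domRestrict_apply, hΦ, hinv]
  let r : ({T.faceCenter f}ᶜ : Set X) → X := fun x =>
    if x.1 ∈ Set.range (T.faceMap f) then T.faceMap f (squareRetract (inv x)) else x
  have hne : ∀ z, T.faceMap f z ∈ ({T.faceCenter f}ᶜ : Set X) →
      z ≠ (intervalCenter, intervalCenter) := by
    rintro z hz rfl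
    exact hz rfl
  have hid : ∀ z, T.cellAt (T.faceMap f z) ≠ Sum.inr (Sum.inr f) →
      T.faceMap f (squareRetract (inv (T.faceMap f z))) = T.faceMap f z := by
    intro z hz
    rw [hinv, squareRetract_eq_self]
    exact fun h => hz (T.cellAt_faceMap f h)
  refine ⟨r, ?_, ?_, ?_⟩
  · have hcl : IsClosed {x : ({T.faceCenter f}ᶜ : Set X) | x.1 ∈ Set.range (T.faceMap f)} :=
      hemb.isClosed_range.preimage continuous_subtype_val
    -- The open face is open in `X`, so the frontier of the closed face misses it; there the radial
    -- retraction is the identity and the two formulas agree.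
    refine continuous_if ?_ ?_ continuous_subtype_val.continuousOn
    · intro x hx
      have hx' := hcl.frontier_subset hx
      obtain ⟨z, hz⟩ : x.1 ∈ Set.range (T.faceMap f) := hx'
      rw [← hz]
      refine hid z fun hc => ?_
      refine hx.2 (mem_interior.2 ⟨Subtype.val ⁻¹' T.openCell (Sum.inr (Sum.inr f)), ?_,
        (T.isOpen_openCell_face f).preimage continuous_subtype_val, ?_⟩)
      · exact fun y hy => T.openCell_subset_closedCell (Sum.inr (Sum.inr f)) hy
      · rw [Set.mem_preimage, ← hz, ← hc]
        exact T.mem_openCell_cellAt _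
    · rw [hcl.closure_eq]
      refine (T.continuous_faceMap f).comp_continuousOn
        (continuousOn_squareRetract.comp
          (hinvc.comp continuous_subtype_val.continuousOn fun x hx => hx) ?_)
      rintro ⟨x, hx⟩ ⟨z, rfl⟩
      simp only [hinv]
      exact hne z hx
  · rintro ⟨x, hx⟩ hc
    by_cases h : x ∈ Set.range (T.faceMap f)
    · simp only [r, if_pos h] at hc
      obtain ⟨z, rfl⟩ := h
      rw [hinv] at hc
      have := T.mem_openCell_cellAt (T.faceMap f (squareRetract z))
      rw [hc] at this
      obtain ⟨w, hw, hwz⟩ := this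
      rw [T.injective_faceMap f hwz] at hw
      exact squareRetract_notMem (hne z hx) hw
    · simp only [r, if_neg h] at hc
      have := T.mem_closedCell_cellAt x
      rw [hc] at this
      exact h this
  · rintro ⟨x, hx⟩ hc
    by_cases h : x ∈ Set.range (T.faceMap f)
    · simp only [r, if_pos h]
      obtain ⟨z, rfl⟩ := h
      exact hid z hc
    · simp only [r, if_neg h]

end QuadrilateralTiling

/-! ### Global potentials of edge labellings -/

namespace QuadrilateralTiling

variable {X V E F : Type*} [TopologicalSpace X] (T : QuadrilateralTiling X V E F)

theorem src_ne_tgt (e : E) : T.src e ≠ T.tgt e := fun h => T.color_ne e (congrArg T.color h)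

theorem eq_src_or_tgt_of_pos_mem {v : V} {e : E}
    (h : T.pos v ∈ T.closedCell (Sum.inr (Sum.inl e))) : v = T.src e ∨ v = T.tgt e := by
  rcases T.cellAt_of_mem_edge h with h' | h' | h' <;> rw [T.cellAt_pos] at h'
  · cases h'
  · exact Or.inl (Sum.inl_injective h')
  · exact Or.inr (Sum.inl_injective h')

theorem corner_succ_ne (f : F) (i : Fin 4) : T.corner f i ≠ T.corner f (i + 1) := by
  intro h
  have h' := congrArg T.pos h
  rw [← T.faceMap_corner, ← T.faceMap_corner] at h'
  have := T.injective_faceMap f h'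
  fin_cases i <;> simp [squareCorner, squareSide] at this

/-- A side and its edge agree only as sets, so their orientations may differ; injectivity of the
face map keeps the two corners distinct. -/
theorem side_endpoints (f : F) (i : Fin 4) :
    (T.corner f i = T.src (T.side f i) ∧ T.corner f (i + 1) = T.tgt (T.side f i)) ∨
      (T.corner f i = T.tgt (T.side f i) ∧ T.corner f (i + 1) = T.src (T.side f i)) := by
  have h0 : T.pos (T.corner f i) ∈ T.closedCell (Sum.inr (Sum.inl (T.side f i))) := by
    rw [← T.faceMap_corner]
    exact T.faceMap_squareSide_mem f i 0
  have h1 : T.pos (T.corner f (i + 1)) ∈ T.closedCell (Sum.inr (Sum.inl (T.side f i))) := by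
    rw [← T.faceMap_corner, ← squareSide_one]
    exact T.faceMap_squareSide_mem f i 1
  have hne := T.corner_succ_ne f i
  rcases T.eq_src_or_tgt_of_pos_mem h0 with h | h <;>
    rcases T.eq_src_or_tgt_of_pos_mem h1 with h' | h'
  · exact absurd (h.trans h'.symm) hne
  · exact Or.inl ⟨h, h'⟩
  · exact Or.inr ⟨h, h'⟩
  · exact absurd (h.trans h'.symm) hne

open Topology in
/-- If the complement of the centre of a face is simply connected, then an edge labelling with a
potential on every other face has a global potential. -/
theorem exists_potential [T2Space X] [Finite V] [Finite E] [Finite F] (f₀ : F)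
    [SimplyConnectedSpace ({T.faceCenter f₀}ᶜ : Set X)]
    [LocallyPathConnectedSpace ({T.faceCenter f₀}ᶜ : Set X)]
    {G : Type*} [Group G] (g : E → G)
    (hg : ∀ f, f ≠ f₀ → ∃ φ : V → G, ∀ i,
      φ (T.tgt (T.side f i)) = φ (T.src (T.side f i)) * g (T.side f i)) :
    ∃ k : V → G, ∀ e, k (T.tgt e) = k (T.src e) * g e := by
  classical
  obtain ⟨r, hrc, hr₀, hr⟩ := T.exists_retraction f₀
  -- Each closed cell other than `f₀` carries a potential for the edges whose interiors meet it. The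
  -- arbitrary choice at `f₀` does no harm, since `r` avoids the open face `f₀`.
  have hloc : ∀ c : V ⊕ E ⊕ F, ∃ φ : V → G, c ≠ Sum.inr (Sum.inr f₀) → ∀ e,
      (∃ t ∈ Set.Ioo (0 : I) 1, T.edgeMap e t ∈ T.closedCell c) →
        φ (T.tgt e) = φ (T.src e) * g e := by
    rintro (v | e' | f)
    · refine ⟨1, fun _ e ⟨t, ht, h⟩ => ?_⟩
      rcases T.eq_of_edgeMap_mem_closedCell ht h with h | ⟨f, i, h, -⟩ <;> cases h
    · refine ⟨fun v => if v = T.tgt e' then g e' else 1, fun _ e ⟨t, ht, h⟩ => ?_⟩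
      rcases T.eq_of_edgeMap_mem_closedCell ht h with h | ⟨f, i, h, -⟩ <;> cases h
      simp [T.src_ne_tgt]
    · by_cases hf : f = f₀
      · exact ⟨1, fun hc => absurd (hf ▸ rfl) hc⟩
      obtain ⟨φ, hφ⟩ := hg f hf
      refine ⟨φ, fun _ e ⟨t, ht, hmem⟩ => ?_⟩
      rcases T.eq_of_edgeMap_mem_closedCell ht hmem with h | ⟨f', i, h, rfl⟩
      · cases h
      obtain rfl : f = f' := Sum.inr_injective (Sum.inr_injective h)
      exact hφ i
  choose ψ hψ using hloc
  let φ : ({T.faceCenter f₀}ᶜ : Set X) → V → G := fun x => ψ (T.cellAt (r x))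
  have hφ : ∀ x, ∀ e, (∃ t ∈ Set.Ioo (0 : I) 1, T.edgeMap e t ∈ T.closedCell (T.cellAt (r x))) →
      φ x (T.tgt e) = φ x (T.src e) * g e := fun x => hψ _ (hr₀ x)
  obtain ⟨h, hconst, htrans⟩ := exists_locally_constant_trivialization
    (fun v : V => r ⁻¹' T.openStar (T.pos v)) (fun v => (T.isOpen_openStar _).preimage hrc)
    (fun x => by
      change ∃ v, T.pos v ∈ T.closedCell (T.cellAt (r x))
      rcases T.cellAt (r x) with v | e | f
      · exact ⟨v, rfl⟩
      · exact ⟨T.src e, T.pos_src_mem e⟩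
      · exact ⟨T.corner f 0, squareCorner 0, T.faceMap_corner f 0⟩)
    φ (by
      intro v w x ⟨hv, hw⟩
      change T.pos v ∈ T.closedCell (T.cellAt (r x)) at hv
      change T.pos w ∈ T.closedCell (T.cellAt (r x)) at hw
      -- For `y` near `x`, the closed cell of `r y` contains `r x`. If `r x` lies inside an edge,
      -- both potentials obey the relation of that edge; if it lies inside a face, the two cells
      -- coincide.
      filter_upwards [((T.isOpen_openStar (r x)).preimage hrc).mem_nhds (T.mem_openStar_self _)]
        with y hy
      change r x ∈ T.closedCell (T.cellAt (r y)) at hy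
      have hmem := T.mem_openCell_cellAt (r x)
      have hx := hφ x
      rcases hc : T.cellAt (r x) with u | e | f <;> rw [hc] at hv hw hmem hx
      · rw [T.pos_injective hv, T.pos_injective hw]
        simp
      · obtain ⟨t, ht, hxt⟩ := hmem
        have hx' := hx e ⟨t, ht, ⟨t, rfl⟩⟩
        have hy' := hφ y e ⟨t, ht, hxt ▸ hy⟩
        rcases T.eq_src_or_tgt_of_pos_mem hv with rfl | rfl <;>
          rcases T.eq_src_or_tgt_of_pos_mem hw with rfl | rfl <;> simp [hx', hy', mul_assoc]
      · have hcy := T.cellAt_eq_of_mem_closedCell_of_face hc hy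
        change (ψ (T.cellAt (r y)) v)⁻¹ * ψ (T.cellAt (r y)) w =
          (ψ (T.cellAt (r x)) v)⁻¹ * ψ (T.cellAt (r x)) w
        rw [hcy, hc])
  have hB : ∀ e t, T.edgeMap e t ∈ ({T.faceCenter f₀}ᶜ : Set X) ∧
      T.cellAt (T.edgeMap e t) ≠ Sum.inr (Sum.inr f₀) := by
    intro e t
    have h1 : T.cellAt (T.edgeMap e t) ≠ Sum.inr (Sum.inr f₀) := by
      intro hc
      rcases T.cellAt_of_mem_edge (e := e) ⟨t, rfl⟩ with h' | h' | h' <;> rw [hc] at h' <;>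
        cases h'
    exact ⟨fun hc => h1 (by rw [hc, T.cellAt_faceCenter]), h1⟩
  let b : E → I → ({T.faceCenter f₀}ᶜ : Set X) := fun e t => ⟨T.edgeMap e t, (hB e t).1⟩
  have hbc : ∀ e, Continuous (b e) := fun e => (T.continuous_edgeMap e).subtype_mk _
  have hrb : ∀ e t, r (b e t) = T.edgeMap e t := fun e t => hr (b e t) (hB e t).2
  have hp : ∀ v, ∃ x : ({T.faceCenter f₀}ᶜ : Set X), x.1 = T.pos v := fun v =>
    ⟨⟨T.pos v, fun hc => by
      have := T.cellAt_faceCenter f₀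
      rw [← (hc : _ = _), T.cellAt_pos] at this
      cases this⟩, rfl⟩
  choose p hp using hp
  have hcell : ∀ e, ∀ t ∈ Set.Ioo (0 : I) 1, T.cellAt (r (b e t)) = Sum.inr (Sum.inl e) :=
    fun e t ht => by rw [hrb, T.cellAt_edgeMap e ht]
  have hb0 : ∀ e, b e 0 = p (T.src e) := fun e => Subtype.ext (by
    rw [hp]; exact T.edgeMap_zero e)
  have hb1 : ∀ e, b e 1 = p (T.tgt e) := fun e => Subtype.ext (by
    rw [hp]; exact T.edgeMap_one e)
  have hconn : ∀ (S : Set I), IsPreconnected S → ∀ e v,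
      (∀ t ∈ S, b e t ∈ r ⁻¹' T.openStar (T.pos v)) → ∀ s ∈ S, ∀ t ∈ S,
        h v (b e s) = h v (b e t) := by
    intro S hS e v hSv s hs t ht
    refine hS.induction₂ (fun s t => h v (b e s) = h v (b e t)) (fun x hx => ?_)
      (fun _ _ _ _ _ _ => Eq.trans) (fun _ _ _ _ => Eq.symm) hs ht
    exact Filter.Eventually.filter_mono nhdsWithin_le_nhds
      ((hconst v _ (hSv x hx)).mono (fun y hy => hy.symm) |> (hbc e).continuousAt.eventually)
  -- Along an edge, `h` at the source is constant up to the midpoint and `h` at the target from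
  -- there on. At the midpoint the two differ by the cocycle, which is `g e`.
  refine ⟨fun v => h v (p v), fun e => ?_⟩
  have hcI := intervalCenter_mem
  have hsrc : ∀ t ∈ Set.Ico (0 : I) 1, b e t ∈ r ⁻¹' T.openStar (T.pos (T.src e)) := by
    intro t ht
    rcases eq_or_lt_of_le ht.1 with rfl | h0
    · rw [Set.mem_preimage, hrb, T.edgeMap_zero]
      exact T.mem_openStar_self _
    · change _ ∈ T.closedCell (T.cellAt (r (b e t)))
      rw [hcell e t ⟨h0, ht.2⟩]
      exact T.pos_src_mem e
  have htgt : ∀ t ∈ Set.Ioc (0 : I) 1, b e t ∈ r ⁻¹' T.openStar (T.pos (T.tgt e)) := by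
    intro t ht
    rcases eq_or_lt_of_le ht.2 with rfl | h0
    · rw [Set.mem_preimage, hrb, T.edgeMap_one]
      exact T.mem_openStar_self _
    · change _ ∈ T.closedCell (T.cellAt (r (b e t)))
      rw [hcell e t ⟨ht.1, h0⟩]
      exact T.pos_tgt_mem e
  have h1 := hconn _ isPreconnected_Ico e _ hsrc 0 ⟨le_rfl, zero_lt_one⟩ intervalCenter
    ⟨hcI.1.le, hcI.2⟩
  have h2 := hconn _ isPreconnected_Ioc e _ htgt 1 ⟨zero_lt_one, le_rfl⟩ intervalCenter
    ⟨hcI.1, hcI.2.le⟩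
  change h (T.tgt e) (p (T.tgt e)) = h (T.src e) (p (T.src e)) * g e
  rw [← hb0, ← hb1, h1, h2, htrans (T.src e) (T.tgt e) (b e intervalCenter)
    ⟨hsrc _ ⟨hcI.1.le, hcI.2⟩, htgt _ ⟨hcI.1, hcI.2.le⟩⟩,
    hφ (b e intervalCenter) e ⟨intervalCenter, hcI, ?_⟩]
  · group
  · rw [hcell e _ hcI]
    exact ⟨_, rfl⟩

end QuadrilateralTiling

/-! ### Real quaternionic cross-ratios as linear dependences -/

/-- The cross-ratio of four quaternions. -/
noncomputable def quaternionCrossRatio (a b c d : ℍ[ℝ]) : ℍ[ℝ] :=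
  (a - b) * (b - c)⁻¹ * (c - d) * (d - a)⁻¹

theorem Quaternion.normSq_smul_inv (a : ℍ[ℝ]) : Quaternion.normSq a • a⁻¹ = star a := by
  by_cases h : a = 0
  · simp [h]
  · rw [Quaternion.inv_def, smul_smul, mul_inv_cancel₀ (Quaternion.normSq_ne_zero.2 h), one_smul]

/-- Factoring out `a` and `c` exhibits the cross-ratio as a conjugate by `a`, and conjugation does
not affect being equal to a given real number. -/
theorem quaternionCrossRatio_zero_eq_coe_iff {a b c : ℍ[ℝ]} (ha : a ≠ 0) (hc : c ≠ 0)
    (hbc : b ≠ c) (r : ℝ) :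
    quaternionCrossRatio a b c 0 = r ↔ a⁻¹ * b - r • (c⁻¹ * b) = ((1 - r : ℝ) : ℍ[ℝ]) := by
  have hv : c⁻¹ * b - 1 ≠ 0 := by
    intro h
    rw [sub_eq_zero, inv_mul_eq_one₀ hc] at h
    exact hbc h.symm
  have h1 : a - b = a * (1 - a⁻¹ * b) := by
    rw [mul_sub, mul_one, mul_inv_cancel_left₀ ha]
  have h2 : b - c = c * (c⁻¹ * b - 1) := by
    rw [mul_sub, mul_one, mul_inv_cancel_left₀ hc]
  have h3 : quaternionCrossRatio a b c 0
      = a * (-((1 - a⁻¹ * b) * (c⁻¹ * b - 1)⁻¹)) * a⁻¹ := by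
    rw [quaternionCrossRatio, h2, h1, sub_zero, zero_sub, mul_inv_rev, inv_neg]
    simp only [mul_assoc, inv_mul_cancel_left₀ hc, mul_neg, neg_mul]
  have h4 : ∀ u : ℍ[ℝ], a * u * a⁻¹ = r ↔ u = r := by
    intro u
    rw [mul_inv_eq_iff_eq_mul₀ ha, Quaternion.coe_commutes, mul_right_inj' ha]
  rw [h3, h4, neg_eq_iff_eq_neg, mul_inv_eq_iff_eq_mul₀ hv, neg_mul, mul_sub, mul_one,
    Quaternion.coe_mul_eq_smul, Quaternion.coe_sub, Quaternion.coe_one, sub_eq_iff_eq_add,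
    sub_eq_iff_eq_add]
  constructor <;> intro h
  · rw [h]; abel
  · rw [h]; abel

/-- Inversion sends circles through `0` to lines. As `normSq a • a⁻¹ = star a`, conjugating the
vector relation turns it into an affine dependence of the three inverses, the norm relation saying
that its coefficients sum to zero. -/
theorem exists_weights_iff_quaternionCrossRatio_zero {a b c : ℍ[ℝ]} (ha : a ≠ 0) (hc : c ≠ 0)
    (hab : a ≠ b) (hbc : b ≠ c) :
    (∃ α β γ : ℝ, ¬ (α = 0 ∧ β = 0 ∧ γ = 0) ∧ α • a + β • b + γ • c = 0 ∧
      α * Quaternion.normSq a + β * Quaternion.normSq b + γ * Quaternion.normSq c = 0) ↔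
    ∃ r : ℝ, quaternionCrossRatio a b c 0 = r := by
  simp only [quaternionCrossRatio_zero_eq_coe_iff ha hc hbc]
  have hna := Quaternion.normSq_ne_zero.2 ha
  have hnc := Quaternion.normSq_ne_zero.2 hc
  by_cases hb : b = 0
  · subst hb
    -- The fourth point is `0` as well, so `b` alone carries a weight, and the cross-ratio is `1`.
    exact iff_of_true ⟨0, 1, 0, by simp⟩ ⟨1, by simp⟩
  have hnb := Quaternion.normSq_ne_zero.2 hb
  have key : ∀ r : ℝ, a⁻¹ * b - r • (c⁻¹ * b) = ((1 - r : ℝ) : ℍ[ℝ]) ↔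
      a⁻¹ - r • c⁻¹ = (1 - r) • b⁻¹ := by
    intro r
    rw [← smul_mul_assoc, ← sub_mul, ← Quaternion.coe_mul_eq_smul (1 - r),
      eq_mul_inv_iff_mul_eq₀ hb]
  simp only [key]
  constructor
  · rintro ⟨α, β, γ, hne, h1, h2⟩
    have h3 : (α * Quaternion.normSq a) • a⁻¹ + (β * Quaternion.normSq b) • b⁻¹ +
        (γ * Quaternion.normSq c) • c⁻¹ = 0 := by
      simp only [mul_smul, Quaternion.normSq_smul_inv]
      simpa using congrArg star h1
    have h4 : β * Quaternion.normSq b = -(α * Quaternion.normSq a + γ * Quaternion.normSq c) := by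
      linarith
    rw [h4] at h3
    have hα : α ≠ 0 := by
      rintro rfl
      have h5 : (γ * Quaternion.normSq c) • (c⁻¹ - b⁻¹) = 0 := by
        rw [← h3]; module
      rcases smul_eq_zero.1 h5 with h | h
      · have hγ : γ = 0 := (mul_eq_zero.1 h).resolve_right hnc
        have hβ : β = 0 := by
          refine (mul_eq_zero.1 ?_).resolve_right hnb
          rw [h4, hγ]; simp
        exact hne ⟨rfl, hβ, hγ⟩
      · exact hbc (inv_injective (sub_eq_zero.1 h)).symm
    have hA : α * Quaternion.normSq a ≠ 0 := mul_ne_zero hα hna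
    refine ⟨-(γ * Quaternion.normSq c) / (α * Quaternion.normSq a), ?_⟩
    set A := α * Quaternion.normSq a
    set C := γ * Quaternion.normSq c
    refine smul_right_injective _ hA ?_
    change A • (_ - _) = A • (_ • _)
    rw [smul_sub, smul_smul, smul_smul, mul_sub, mul_div_cancel₀ _ hA, ← sub_eq_zero, ← h3]
    module
  · rintro ⟨r, hr⟩
    refine ⟨(Quaternion.normSq a)⁻¹, -(1 - r) * (Quaternion.normSq b)⁻¹,
      -r * (Quaternion.normSq c)⁻¹, fun h => inv_ne_zero hna h.1, ?_, ?_⟩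
    · have h1 : ∀ x : ℍ[ℝ], (Quaternion.normSq x)⁻¹ • x = star x⁻¹ := by
        intro x
        rw [Quaternion.inv_def]
        simp
      have h2 : star a⁻¹ - r • star c⁻¹ = (1 - r) • star b⁻¹ := by
        simpa only [star_sub, Quaternion.star_smul] using congrArg star hr
      simp only [mul_smul, h1]
      rw [eq_add_of_sub_eq h2]
      module
    · rw [inv_mul_cancel₀ hna, inv_mul_cancel_right₀ hnb, inv_mul_cancel_right₀ hnc]
      ring

/-- The weights express linear dependence of the lifts `(1, x i, normSq (x i))`, a condition
invariant under translation; moving `x 3` to `0` leaves three weights. -/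
theorem exists_weights_iff_quaternionCrossRatio {x : Fin 4 → ℍ[ℝ]} (h01 : x 0 ≠ x 1)
    (h12 : x 1 ≠ x 2) (h23 : x 2 ≠ x 3) (h30 : x 3 ≠ x 0) :
    (∃ μ : Fin 4 → ℝ, μ ≠ 0 ∧ ∑ i, μ i = 0 ∧ ∑ i, μ i • x i = 0 ∧
      ∑ i, μ i * Quaternion.normSq (x i) = 0) ↔
    ∃ r : ℝ, quaternionCrossRatio (x 0) (x 1) (x 2) (x 3) = r := by
  have hcr : quaternionCrossRatio (x 0) (x 1) (x 2) (x 3) =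
      quaternionCrossRatio (x 0 - x 3) (x 1 - x 3) (x 2 - x 3) 0 := by
    simp [quaternionCrossRatio]
  rw [hcr, ← exists_weights_iff_quaternionCrossRatio_zero (sub_ne_zero.2 h30.symm)
    (sub_ne_zero.2 h23) (sub_left_injective.ne h01) (sub_left_injective.ne h12)]
  simp only [Fin.sum_univ_four, Quaternion.ext_iff, Quaternion.normSq_def', Quaternion.re_add,
    Quaternion.imI_add, Quaternion.imJ_add, Quaternion.imK_add, Quaternion.re_smul,
    Quaternion.imI_smul, Quaternion.imJ_smul, Quaternion.imK_smul, Quaternion.re_sub,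
    Quaternion.imI_sub, Quaternion.imJ_sub, Quaternion.imK_sub, Quaternion.re_zero,
    Quaternion.imI_zero, Quaternion.imJ_zero, Quaternion.imK_zero, smul_eq_mul]
  constructor
  · rintro ⟨μ, hne, hs, ⟨h1, h2, h3, h4⟩, h5⟩
    refine ⟨μ 0, μ 1, μ 2, ?_, ⟨?_, ?_, ?_, ?_⟩, ?_⟩
    · rintro ⟨e0, e1, e2⟩
      apply hne
      ext i
      fin_cases i <;> simp_all
    · linear_combination h1 - hs * (x 3).re
    · linear_combination h2 - hs * (x 3).imI
    · linear_combination h3 - hs * (x 3).imJ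
    · linear_combination h4 - hs * (x 3).imK
    · linear_combination h5 - 2 * (x 3).re * h1 - 2 * (x 3).imI * h2 - 2 * (x 3).imJ * h3 -
        2 * (x 3).imK * h4 + hs * ((x 3).re ^ 2 + (x 3).imI ^ 2 + (x 3).imJ ^ 2 + (x 3).imK ^ 2)
  · rintro ⟨α, β, γ, hne, ⟨h1, h2, h3, h4⟩, h5⟩
    refine ⟨![α, β, γ, -(α + β + γ)], ?_, ?_, ⟨?_, ?_, ?_, ?_⟩, ?_⟩
    · intro h
      exact hne ⟨congrFun h 0, congrFun h 1, congrFun h 2⟩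
    all_goals simp
    · linear_combination h1
    · linear_combination h2
    · linear_combination h3
    · linear_combination h4
    · linear_combination h5 + 2 * (x 3).re * h1 + 2 * (x 3).imI * h2 + 2 * (x 3).imJ * h3 +
        2 * (x 3).imK * h4

/-! ### Coplanarity in stereographic coordinates -/

theorem coplanar_range_iff_exists_weights {W : Type*} [NormedAddCommGroup W]
    [InnerProductSpace ℝ W] (p : Fin 4 → W) :
    Coplanar ℝ (Set.range p) ↔
      ∃ w : Fin 4 → ℝ, w ≠ 0 ∧ ∑ i, w i = 0 ∧ ∑ i, w i • p i = 0 := by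
  have : FiniteDimensional ℝ (vectorSpan ℝ (Set.range p)) :=
    finiteDimensional_vectorSpan_range ℝ p
  rw [coplanar_iff_finrank_le_two, ← not_iff_not,
    ← affineIndependent_iff_not_finrank_vectorSpan_le ℝ p (n := 2) (by simp),
    affineIndependent_iff_of_fintype]
  simp only [not_exists, not_and]
  refine forall_congr' fun w => ?_
  constructor
  · intro h hne hs hp
    refine hne (funext (h hs ?_))
    rw [Finset.univ.weightedVSub_eq_linear_combination hs, hp]
  · intro h hs hp
    rw [Finset.univ.weightedVSub_eq_linear_combination hs] at hp
    by_contra hne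
    exact h (fun h0 => hne (congrFun h0)) hs hp

/-- Stereographic coordinates: a linear functional `τ` and a linear map `L` to the quaternions with
`‖a‖ ^ 2 = τ a ^ 2 + normSq (L a)` turn coplanarity of points of the unit sphere away from the pole
into reality of the quaternionic cross-ratio. -/
theorem coplanar_iff_quaternionCrossRatio {W : Type*} [NormedAddCommGroup W]
    [InnerProductSpace ℝ W] (τ : W →ₗ[ℝ] ℝ) (L : W →ₗ[ℝ] ℍ[ℝ])
    (hL : ∀ a, ‖a‖ ^ 2 = τ a ^ 2 + Quaternion.normSq (L a)) (p : Fin 4 → W)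
    (hp : ∀ i, ‖p i‖ = 1) (hτ : ∀ i, τ (p i) ≠ 1) (x : Fin 4 → ℍ[ℝ])
    (hx : ∀ i, x i = (1 - τ (p i))⁻¹ • L (p i)) (h01 : x 0 ≠ x 1)
    (h12 : x 1 ≠ x 2) (h23 : x 2 ≠ x 3) (h30 : x 3 ≠ x 0) :
    Coplanar ℝ (Set.range p) ↔
      ∃ r : ℝ, quaternionCrossRatio (x 0) (x 1) (x 2) (x 3) = r := by
  have hs : ∀ i, 1 - τ (p i) ≠ 0 := fun i => sub_ne_zero.2 (hτ i).symm
  have hLx : ∀ i, L (p i) = (1 - τ (p i)) • x i := fun i => by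
    rw [hx, smul_inv_smul₀ (hs i)]
  -- Hence `(1 - τ, L, 1 + τ)` at `p i` is `1 - τ (p i)` times the lift `(1, x i, normSq (x i))`, so
  -- weights for `p` and for `x` differ by the factors `1 - τ (p i)`.
  have hn : ∀ i, (1 - τ (p i)) * Quaternion.normSq (x i) = 1 + τ (p i) := by
    intro i
    have h := hL (p i)
    rw [hp, hLx, Quaternion.normSq_smul] at h
    apply mul_left_cancel₀ (hs i)
    linear_combination -h
  have hker : ∀ a, τ a = 0 → L a = 0 → a = 0 := by
    intro a h1 h2
    have := hL a
    rw [h1, h2] at this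
    simpa using this
  rw [coplanar_range_iff_exists_weights, ← exists_weights_iff_quaternionCrossRatio h01 h12 h23 h30]
  constructor
  · rintro ⟨w, hne, h0, h1⟩
    have h2 : ∑ i, w i * τ (p i) = 0 := by simpa using congrArg τ h1
    have h3 : ∑ i, w i • L (p i) = 0 := by simpa using congrArg L h1
    refine ⟨fun i => w i * (1 - τ (p i)), ?_, ?_, ?_, ?_⟩
    · intro h
      exact hne (funext fun i => (mul_eq_zero.1 (congrFun h i)).resolve_right (hs i))
    · simp [mul_sub, Finset.sum_sub_distrib, h0, h2]
    · rw [← h3]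
      exact Finset.sum_congr rfl fun i _ => by rw [hLx, mul_smul]
    · simp only [mul_assoc, hn, mul_add, mul_one, Finset.sum_add_distrib, h0, h2, add_zero]
  · rintro ⟨μ, hne, h0, h1, h2⟩
    have hw : ∀ i, μ i = μ i * (1 - τ (p i))⁻¹ * (1 - τ (p i)) := fun i =>
      (inv_mul_cancel_right₀ (hs i) _).symm
    set w : Fin 4 → ℝ := fun i => μ i * (1 - τ (p i))⁻¹
    have h0' : ∑ i, w i * (1 - τ (p i)) = 0 := by
      rw [← h0]; exact Finset.sum_congr rfl fun i _ => (hw i).symm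
    have h2' : ∑ i, w i * (1 + τ (p i)) = 0 := by
      rw [← h2]
      refine Finset.sum_congr rfl fun i _ => ?_
      rw [← hn, ← mul_assoc, ← hw i]
    have h1' : ∑ i, w i • L (p i) = 0 := by
      rw [← h1]
      refine Finset.sum_congr rfl fun i _ => ?_
      rw [hLx, smul_smul, ← hw i]
    simp only [mul_sub, mul_add, mul_one, Finset.sum_sub_distrib, Finset.sum_add_distrib]
      at h0' h2'
    refine ⟨w, ?_, by linarith, hker _ ?_ (by simpa using h1')⟩
    · intro h
      refine hne (funext fun i => ?_)
      rw [hw i]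
      change w i * _ = 0
      rw [h]; simp
    · simp only [map_sum, map_smul, smul_eq_mul]
      linarith

/-- Stereographic coordinates are injective away from the pole. -/
theorem stereographic_coordinates_injective {W : Type*} [NormedAddCommGroup W]
    [InnerProductSpace ℝ W] (τ : W →ₗ[ℝ] ℝ) (L : W →ₗ[ℝ] ℍ[ℝ])
    (hL : ∀ a, ‖a‖ ^ 2 = τ a ^ 2 + Quaternion.normSq (L a)) {a b : W}
    (ha : ‖a‖ = 1) (hb : ‖b‖ = 1) (ha' : τ a ≠ 1) (hb' : τ b ≠ 1)
    (h : (1 - τ a)⁻¹ • L a = (1 - τ b)⁻¹ • L b) : a = b := by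
  have hsa : 1 - τ a ≠ 0 := sub_ne_zero.2 ha'.symm
  have hsb : 1 - τ b ≠ 0 := sub_ne_zero.2 hb'.symm
  have h1 := hL a
  have h2 := hL b
  have h3 := congrArg Quaternion.normSq h
  rw [ha] at h1
  rw [hb] at h2
  rw [Quaternion.normSq_smul, Quaternion.normSq_smul,
    show Quaternion.normSq (L a) = (1 - τ a) * (1 + τ a) by linear_combination -h1,
    show Quaternion.normSq (L b) = (1 - τ b) * (1 + τ b) by linear_combination -h2] at h3
  have h4 : τ a = τ b := by
    field_simp at h3
    linarith
  have h5 : L a = L b := by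
    rw [h4] at h
    exact smul_right_injective _ (inv_ne_zero hsb) h
  have h6 := hL (a - b)
  rw [map_sub, map_sub, h4, h5] at h6
  simpa [sub_eq_zero] using h6

/-- Extend `N` to an orthonormal basis: `τ` is the coordinate along `N`, and the other four are the
components of `L`. -/
theorem exists_stereographic_coordinates {N : EuclideanSpace ℝ (Fin 5)} (hN : ‖N‖ = 1) :
    ∃ (τ : EuclideanSpace ℝ (Fin 5) →ₗ[ℝ] ℝ) (L : EuclideanSpace ℝ (Fin 5) →ₗ[ℝ] ℍ[ℝ]),
      (∀ a, ‖a‖ ^ 2 = τ a ^ 2 + Quaternion.normSq (L a)) ∧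
      ∀ a, ‖a‖ = 1 → τ a = 1 → a = N := by
  obtain ⟨b, hb⟩ := Orthonormal.exists_orthonormalBasis_extension_of_card_eq (𝕜 := ℝ)
    (E := EuclideanSpace ℝ (Fin 5)) (ι := Fin 5) (by simp) (v := fun _ => N) (s := {0}) (by
      rw [orthonormal_iff_ite]
      rintro ⟨i, rfl⟩ ⟨j, rfl⟩
      simp [hN])
  have hb0 : b 0 = N := hb 0 rfl
  obtain ⟨L, h1, h2, h3, h4⟩ : ∃ L : EuclideanSpace ℝ (Fin 5) →ₗ[ℝ] ℍ[ℝ],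
      (∀ a, (L a).re = inner ℝ (b 1) a) ∧ (∀ a, (L a).imI = inner ℝ (b 2) a) ∧
      (∀ a, (L a).imJ = inner ℝ (b 3) a) ∧ ∀ a, (L a).imK = inner ℝ (b 4) a :=
    ⟨{  toFun := fun a =>
          ⟨inner ℝ (b 1) a, inner ℝ (b 2) a, inner ℝ (b 3) a, inner ℝ (b 4) a⟩
        map_add' := fun a c => Quaternion.ext _ _ (inner_add_right _ _ _) (inner_add_right _ _ _)
          (inner_add_right _ _ _) (inner_add_right _ _ _)
        map_smul' := fun a c => Quaternion.ext _ _ (inner_smul_right _ _ _)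
          (inner_smul_right _ _ _) (inner_smul_right _ _ _) (inner_smul_right _ _ _) },
      fun _ => rfl, fun _ => rfl, fun _ => rfl, fun _ => rfl⟩
  refine ⟨innerₛₗ ℝ N, L, ?_, ?_⟩
  · intro a
    rw [← b.sum_sq_inner_right a, Fin.sum_univ_five, hb0, Quaternion.normSq_def', h1, h2, h3, h4,
      innerₛₗ_apply_apply]
    ring
  · intro a ha h
    exact ((inner_eq_one_iff_of_norm_eq_one hN ha).1 h).symm

/-! ### Quaternions modulo the centre -/

/-- The projective class of a nonzero quaternion; the class of `0` is `1` by convention. -/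
noncomputable def quaternionClass (a : ℍ[ℝ]) : ℍ[ℝ]ˣ ⧸ Subgroup.center ℍ[ℝ]ˣ :=
  open scoped Classical in if h : a = 0 then 1 else (Units.mk0 a h : ℍ[ℝ]ˣ)

theorem quaternionClass_neg (a : ℍ[ℝ]) : quaternionClass (-a) = quaternionClass a := by
  by_cases h : a = 0
  · simp [h]
  · rw [quaternionClass, quaternionClass, dif_neg h, dif_neg (neg_ne_zero.2 h), QuotientGroup.eq,
      Subgroup.mem_center_iff]
    intro g
    ext1
    simp only [Units.val_mul, Units.val_inv_eq_inv_val, Units.val_mk0]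
    rw [inv_neg, neg_mul, inv_mul_cancel₀ h, mul_neg, neg_mul, one_mul, mul_one]

theorem Quaternion.units_mem_center_iff (u : ℍ[ℝ]ˣ) :
    u ∈ Subgroup.center ℍ[ℝ]ˣ ↔ ∃ r : ℝ, (u : ℍ[ℝ]) = r := by
  rw [Subgroup.mem_center_iff]
  constructor
  · intro h
    have key : ∀ q : ℍ[ℝ], q ≠ 0 → q * u = u * q := fun q hq =>
      congrArg Units.val (h (Units.mk0 q hq))
    -- Commuting with `i` and `j` already kills all imaginary parts.
    obtain ⟨i, i0, i1, i2, i3⟩ : ∃ q : ℍ[ℝ], q.re = 0 ∧ q.imI = 1 ∧ q.imJ = 0 ∧ q.imK = 0 :=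
      ⟨⟨0, 1, 0, 0⟩, rfl, rfl, rfl, rfl⟩
    obtain ⟨j, j0, j1, j2, j3⟩ : ∃ q : ℍ[ℝ], q.re = 0 ∧ q.imI = 0 ∧ q.imJ = 1 ∧ q.imK = 0 :=
      ⟨⟨0, 0, 1, 0⟩, rfl, rfl, rfl, rfl⟩
    have h1 := key i (by rintro rfl; simp at i1)
    have h2 := key j (by rintro rfl; simp at j2)
    simp only [Quaternion.ext_iff, Quaternion.re_mul, Quaternion.imI_mul, Quaternion.imJ_mul,
      Quaternion.imK_mul, i0, i1, i2, i3, j0, j1, j2, j3] at h1 h2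
    refine ⟨(u : ℍ[ℝ]).re, ?_⟩
    ext <;> simp <;> linarith [h1.2.2.1, h1.2.2.2, h2.2.1, h2.2.2.2]
  · rintro ⟨r, hr⟩ g
    ext1
    rw [Units.val_mul, Units.val_mul, hr, Quaternion.coe_commutes]

theorem quaternionClass_crossRatio_eq_one_iff {a b c d : ℍ[ℝ]} (hab : a ≠ b) (hbc : b ≠ c)
    (hcd : c ≠ d) (hda : d ≠ a) :
    quaternionClass (a - b) * (quaternionClass (b - c))⁻¹ * quaternionClass (c - d) *
      (quaternionClass (d - a))⁻¹ = 1 ↔ ∃ r : ℝ, quaternionCrossRatio a b c d = r := by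
  simp only [quaternionClass, dif_neg (sub_ne_zero.2 hab), dif_neg (sub_ne_zero.2 hbc),
    dif_neg (sub_ne_zero.2 hcd), dif_neg (sub_ne_zero.2 hda)]
  rw [← QuotientGroup.mk_inv, ← QuotientGroup.mk_inv, ← QuotientGroup.mk_mul,
    ← QuotientGroup.mk_mul, ← QuotientGroup.mk_mul, QuotientGroup.eq_one_iff,
    Quaternion.units_mem_center_iff]
  simp [quaternionCrossRatio]

/-! ### The punctured sphere -/

theorem sphere_compl_singleton_simplyConnected_locallyPathConnected {W : Type*}
    [NormedAddCommGroup W]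
    [InnerProductSpace ℝ W] (p : Metric.sphere (0 : W) 1) :
    SimplyConnectedSpace ({p}ᶜ : Set (Metric.sphere (0 : W) 1)) ∧
      LocallyPathConnectedSpace ({p}ᶜ : Set (Metric.sphere (0 : W) 1)) := by
  have hp : ‖(p : W)‖ = 1 := norm_eq_of_mem_sphere p
  let e := (stereographic hp).toHomeomorphSourceTarget
  have hs : (stereographic hp).source = {p}ᶜ := stereographic_source hp
  have ht : (stereographic hp).target = Set.univ := stereographic_target hp
  let e' : ({p}ᶜ : Set (Metric.sphere (0 : W) 1)) ≃ₜ (ℝ ∙ (p : W))ᗮ :=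
    (Homeomorph.setCongr hs.symm).trans (e.trans ((Homeomorph.setCongr ht).trans
      (Homeomorph.Set.univ _)))
  exact ⟨e'.toHomotopyEquiv.simplyConnectedSpace, e'.isOpenEmbedding.locallyPathConnectedSpace⟩

/-! ### Holonomy around faces -/

namespace QuadrilateralTiling

variable {X V E F : Type*} [TopologicalSpace X] (T : QuadrilateralTiling X V E F)

theorem color_corner_succ (f : F) (i : Fin 4) :
    T.color (T.corner f (i + 1)) = !T.color (T.corner f i) := by
  have h := T.color_ne (T.side f i)
  rw [Bool.eq_not]
  rcases T.side_endpoints f i with ⟨h1, h2⟩ | ⟨h1, h2⟩ <;> rw [h1, h2]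
  · exact h.symm
  · exact h

theorem corner_injective (f : F) : Function.Injective (T.corner f) := by
  intro i j h
  have h' := congrArg T.pos h
  rw [← T.faceMap_corner, ← T.faceMap_corner] at h'
  have := T.injective_faceMap f h'
  fin_cases i <;> fin_cases j <;> simp [squareCorner, squareSide] at this ⊢

/-- A side relation for a potential may be read along the boundary of the face. -/
theorem potential_side_iff {G : Type*} [Group G] {w : V → V → G}
    (hw : ∀ u v, w v u = (w u v)⁻¹) (k : V → G) (f : F) (i : Fin 4) :
    k (T.tgt (T.side f i)) = k (T.src (T.side f i)) * w (T.src (T.side f i)) (T.tgt (T.side f i)) ↔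
      k (T.corner f (i + 1)) = k (T.corner f i) * w (T.corner f i) (T.corner f (i + 1)) := by
  rcases T.side_endpoints f i with ⟨h1, h2⟩ | ⟨h1, h2⟩
  · rw [h1, h2]
  · rw [h1, h2, hw (T.src _) (T.tgt _), eq_mul_inv_iff_mul_eq, eq_comm]

/-- The holonomy of a labelling of ordered pairs of vertices along the boundary of a face. -/
def holonomy {G : Type*} [Group G] (w : V → V → G) (f : F) : G :=
  w (T.corner f 0) (T.corner f 1) * w (T.corner f 1) (T.corner f 2) *
    w (T.corner f 2) (T.corner f 3) * w (T.corner f 3) (T.corner f 0)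

theorem holonomy_eq_one_iff {G : Type*} [Group G] {w : V → V → G}
    (hw : ∀ u v, w v u = (w u v)⁻¹) (f : F) :
    T.holonomy w f = 1 ↔ ∃ k : V → G, ∀ i, k (T.tgt (T.side f i)) =
      k (T.src (T.side f i)) * w (T.src (T.side f i)) (T.tgt (T.side f i)) := by
  simp only [T.potential_side_iff hw, holonomy]
  constructor
  · intro h
    -- Partial products along the boundary, starting from `1` at corner `0`; the holonomy is the
    -- obstruction to closing up.
    let κ : Fin 4 → G := ![1, w (T.corner f 0) (T.corner f 1),
      w (T.corner f 0) (T.corner f 1) * w (T.corner f 1) (T.corner f 2),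
      w (T.corner f 0) (T.corner f 1) * w (T.corner f 1) (T.corner f 2) *
        w (T.corner f 2) (T.corner f 3)]
    refine ⟨fun v => κ (Function.invFun (T.corner f) v), fun i => ?_⟩
    simp only [Function.leftInverse_invFun (T.corner_injective f) _]
    fin_cases i
    · exact (one_mul _).symm
    · rfl
    · rfl
    · exact h.symm
  · rintro ⟨k, hk⟩
    have h0 := hk 0
    have h1 := hk 1
    have h2 := hk 2
    have h3 := hk 3
    simp only [Fin.reduceAdd, zero_add] at h0 h1 h2 h3
    rw [h2, h1, h0] at h3
    simpa [mul_assoc] using h3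

/-- If all faces but one have trivial holonomy, then so does the remaining face. -/
theorem holonomy_eq_one_of_ne [T2Space X] [Finite V] [Finite E] [Finite F] (f₀ : F)
    [SimplyConnectedSpace ({T.faceCenter f₀}ᶜ : Set X)]
    [LocallyPathConnectedSpace ({T.faceCenter f₀}ᶜ : Set X)]
    {G : Type*} [Group G] {w : V → V → G} (hw : ∀ u v, w v u = (w u v)⁻¹)
    (h : ∀ f, f ≠ f₀ → T.holonomy w f = 1) : T.holonomy w f₀ = 1 := by
  obtain ⟨k, hk⟩ := T.exists_potential f₀ (fun e => w (T.src e) (T.tgt e))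
    fun f hf => (T.holonomy_eq_one_iff hw f).1 (h f hf)
  exact (T.holonomy_eq_one_iff hw f₀).2 ⟨k, fun i => hk _⟩

end QuadrilateralTiling

/-! ### Holonomy as the class of the cross-ratio -/

/-- The transition class between two coloured points of `ℍ`: the class of their difference when
read from black to white, and its inverse when read from white to black. -/
noncomputable def quaternionTransition {V : Type*} (color : V → Bool) (x : V → ℍ[ℝ]) (u v : V) :
    ℍ[ℝ]ˣ ⧸ Subgroup.center ℍ[ℝ]ˣ :=
  match color u, color v with
  | true, false => quaternionClass (x u - x v)
  | false, true => (quaternionClass (x u - x v))⁻¹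
  | _, _ => 1

/-- The class of a difference ignores its sign, as `-1` is central, so swapping the endpoints only
swaps the colours. -/
theorem quaternionTransition_symm {V : Type*} (color : V → Bool) (x : V → ℍ[ℝ]) (u v : V) :
    quaternionTransition color x v u = (quaternionTransition color x u v)⁻¹ := by
  unfold quaternionTransition
  rw [← neg_sub (x u) (x v), quaternionClass_neg]
  rcases color u <;> rcases color v <;> simp

theorem exists_notMem_range_sphere {V : Type*} [Finite V]
    (P : V → Metric.sphere (0 : EuclideanSpace ℝ (Fin 5)) 1) : ∃ N, N ∉ Set.range P := by
  by_contra! h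
  have hinf : (Metric.sphere (0 : EuclideanSpace ℝ (Fin 5)) 1).Infinite := by
    refine (isPreconnected_sphere ?_ 0 1).infinite_of_nontrivial ?_
    · rw [← Module.finrank_eq_rank]
      simp
    · refine ⟨EuclideanSpace.single 0 1, by simp, -EuclideanSpace.single 0 1, by simp, ?_⟩
      intro h
      have := congrArg (fun a : EuclideanSpace ℝ (Fin 5) => a 0) h
      norm_num at this
  exact hinf.to_subtype.not_finite (Finite.of_surjective P h)

namespace QuadrilateralTiling

variable {X V E F : Type*} [TopologicalSpace X] (T : QuadrilateralTiling X V E F)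

theorem holonomy_quaternionTransition_eq_one_iff {x : V → ℍ[ℝ]} {W : Type*}
    [NormedAddCommGroup W] [InnerProductSpace ℝ W] {P : V → W}
    (hcop : ∀ c : Fin 4 → V, x (c 0) ≠ x (c 1) → x (c 1) ≠ x (c 2) → x (c 2) ≠ x (c 3) →
      x (c 3) ≠ x (c 0) → (Coplanar ℝ (Set.range (P ∘ c)) ↔
        ∃ r : ℝ, quaternionCrossRatio (x (c 0)) (x (c 1)) (x (c 2)) (x (c 3)) = r))
    (hx : ∀ e, x (T.src e) ≠ x (T.tgt e)) (f : F) :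
    T.holonomy (quaternionTransition T.color x) f = 1 ↔
      Coplanar ℝ (Set.range fun i => P (T.corner f i)) := by
  have hne : ∀ i, x (T.corner f i) ≠ x (T.corner f (i + 1)) := by
    intro i
    rcases T.side_endpoints f i with ⟨h1, h2⟩ | ⟨h1, h2⟩ <;> rw [h1, h2]
    · exact hx _
    · exact (hx _).symm
  have n0 := hne 0
  have n1 := hne 1
  have n2 := hne 2
  have n3 := hne 3
  have c1 := T.color_corner_succ f 0
  have c2 := T.color_corner_succ f 1
  have c3 := T.color_corner_succ f 2
  simp only [Fin.reduceAdd, zero_add] at n0 n1 n2 n3 c1 c2 c3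
  rw [c1] at c2
  rw [c2] at c3
  rw [holonomy]
  cases hc : T.color (T.corner f 0) <;> simp only [hc, Bool.not_true, Bool.not_false] at c1 c2 c3
  · have h := hcop (fun i => T.corner f (i + 1)) n1 n2 n3 n0
    have hr : Set.range (P ∘ fun i => T.corner f (i + 1)) =
        Set.range fun i => P (T.corner f i) :=
      (Equiv.addRight (1 : Fin 4)).surjective.range_comp fun i => P (T.corner f i)
    rw [← hr, h]
    simp only [Fin.reduceAdd, zero_add]
    rw [← quaternionClass_crossRatio_eq_one_iff n1 n2 n3 n0]
    simp only [quaternionTransition, hc, c1, c2, c3, mul_assoc]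
    rw [mul_eq_one_comm]
    simp only [mul_assoc]
  · have h := hcop (T.corner f) n0 n1 n2 n3
    change _ ↔ Coplanar ℝ (Set.range (P ∘ T.corner f))
    rw [h, ← quaternionClass_crossRatio_eq_one_iff n0 n1 n2 n3]
    simp only [quaternionTransition, hc, c1, c2, c3]

end QuadrilateralTiling

theorem mainTheorem8 {V E F : Type*} [Finite V] [Finite E] [Finite F]
    (T : QuadrilateralTiling (Metric.sphere (0 : EuclideanSpace ℝ (Fin 3)) 1) V E F)
    (P : V → Metric.sphere (0 : EuclideanSpace ℝ (Fin 5)) 1)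
    (hP : ∀ e : E, P (T.src e) ≠ P (T.tgt e))
    (f₀ : F)
    (hf : ∀ f : F, f ≠ f₀ → EuclideanGeometry.Concyclic
      (Set.range fun i : Fin 4 => (P (T.corner f i) : EuclideanSpace ℝ (Fin 5)))) :
    EuclideanGeometry.Concyclic
      (Set.range fun i : Fin 4 => (P (T.corner f₀ i) : EuclideanSpace ℝ (Fin 5))) := by
  obtain ⟨N, hN⟩ := exists_notMem_range_sphere P
  obtain ⟨τ, L, hL, hτ⟩ := exists_stereographic_coordinates (norm_eq_of_mem_sphere N)
  have hP1 : ∀ v, ‖(P v : EuclideanSpace ℝ (Fin 5))‖ = 1 := fun v => norm_eq_of_mem_sphere _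
  have hPτ : ∀ v, τ (P v) ≠ 1 := fun v h => hN ⟨v, Subtype.ext (hτ _ (hP1 v) h)⟩
  let x : V → ℍ[ℝ] := fun v => (1 - τ (P v))⁻¹ • L (P v)
  have hiff := T.holonomy_quaternionTransition_eq_one_iff (x := x)
    (P := fun v => (P v : EuclideanSpace ℝ (Fin 5)))
    (fun c => coplanar_iff_quaternionCrossRatio τ L hL _ (fun i => hP1 (c i))
      (fun i => hPτ (c i)) (fun i => x (c i)) fun _ => rfl)
    (fun e h => hP e (Subtype.ext
      (stereographic_coordinates_injective τ L hL (hP1 _) (hP1 _) (hPτ _) (hPτ _) h)))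
  obtain ⟨hsc, hlpc⟩ := sphere_compl_singleton_simplyConnected_locallyPathConnected (T.faceCenter f₀)
  -- Cosphericity comes from the ambient unit sphere; only coplanarity has content.
  refine ⟨⟨0, 1, ?_⟩, (hiff f₀).1 (T.holonomy_eq_one_of_ne f₀
    (quaternionTransition_symm T.color x) fun f h => (hiff f).2 (hf f h).Coplanar)⟩
  rintro _ ⟨i, rfl⟩
  exact (P (T.corner f₀ i)).2
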